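/- Let $n\ge 0$ be an integer and let $u:\{-n,\ldots,n\}\to\mathbb{R}$, extended by zero to $\mathbb{Z}$, be symmetric ($u(-k)=u(k)$) with $\sum_{k=-n}^{n}u(k)=1$ and nonnegative Fourier transform, i.e. $\widehat{u}(\xi)=\sum_{k\in\mathbb{Z}}u(k)e^{-i\xi k}\ge 0$ for all $\xi\in\mathbb{R}$. For $f:\mathbb{Z}\to\mathbb{C}$ write $(\Delta f)(k)=f(k+2)-2f(k+1)+f(k)$. Then $f\mapsto\Delta(f*u)$ is a bounded linear operator on the complex space $\ell^2(\mathbb{Z})$, and $$\sup_{0\neq f\in\ell^2(\mathbb{Z})}\frac{\|\Delta(f*u)\|_{\ell^2(\mathbb{Z})}}{\|f\|_{\ell^2(\mathbb{Z})}}\ \ge\ \frac{4}{(n+1)^2},$$ with equality if and only if $u$ is the triangle function $u(k)=\frac{n+1-|k|}{(n+1)^2}$ for $|k|\le n$. Moreover, the Fourier transform of the triangle function is the normalized Fejér kernel $$\frac{1}{(n+1)^2}\cdot\frac{1-\cos((n+1)\xi)}{1-\cos\xi}\qquad(\xi\notin 2\pi\mathbb{Z}),$$ with value $1$ for $\xi\in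 2\pi\mathbb{Z}$. -/

import Mathlib

open scoped DiscreteConvolution ComplexOrder lp

noncomputable section

/-- The discrete second derivative `(Δ f)(k) = (∇² f)(k) = f (k+2) - 2 f (k+1) + f k` of a function
on `ℤ`. -/
def discreteLaplacian (f : ℤ → ℂ) : ℤ → ℂ :=
  fun k => f (k + 2) - 2 * f (k + 1) + f k

/-- It is the twofold application of the forward difference operator. -/
theorem discreteLaplacian_eq_fwdDiff (f : ℤ → ℂ) :
    discreteLaplacian f = fwdDiff 1 (fwdDiff 1 f) := by
  funext k
  simp only [discreteLaplacian, fwdDiff]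
  rw [show k + 1 + 1 = k + 2 by ring]
  ring

/-- The convolution `(f * u)(k) = ∑_{i + j = k} f i * u j` of a complex function and a real
kernel on `ℤ`. -/
def convolve (f : ℤ → ℂ) (u : ℤ → ℝ) : ℤ → ℂ :=
  f ⋆₊[LinearMap.mul ℂ ℂ] (fun k => (u k : ℂ))

/-- The Fourier transform `û(ξ) = ∑_{k ∈ ℤ} u k * e^{-iξk}`. -/
def fourierSeries (u : ℤ → ℝ) (ξ : ℝ) : ℂ :=
  ∑' k : ℤ, (u k : ℂ) * Complex.exp (-Complex.I * ξ * k)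

/-- The triangle function on `{-n, …, n}`, extended by zero to `ℤ`. -/
def triangle (n : ℕ) (k : ℤ) : ℝ :=
  if |k| ≤ n then ((n : ℝ) + 1 - |(k : ℝ)|) / ((n : ℝ) + 1) ^ 2 else 0

/-- The Fejér kernel normalized to take the value `1` at `0`. For `ξ ∉ 2πℤ` it is
`(1 - cos ((n+1)ξ)) / ((n+1)² (1 - cos ξ))`; its continuous extension to `2πℤ` is `1` there. -/
def normalizedFejer (n : ℕ) (ξ : ℝ) : ℝ :=
  if Real.cos ξ = 1 then 1
  else (1 / ((n : ℝ) + 1) ^ 2) * ((1 - Real.cos (((n : ℝ) + 1) * ξ)) / (1 - Real.cos ξ))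

/-- The convolution as a sum over `ℤ`. -/
theorem convolve_apply (f : ℤ → ℂ) (u : ℤ → ℝ) (k : ℤ) :
    convolve f u k = ∑' j : ℤ, f (k - j) * (u j : ℂ) := by
  let e : ℤ ≃ DiscreteConvolution.addFiber k :=
    { toFun := fun j => ⟨(k - j, j), by simp [DiscreteConvolution.mem_addFiber]⟩
      invFun := fun p => p.1.2
      left_inv := fun j => rfl
      right_inv := fun p => by
        obtain ⟨⟨a, b⟩, h⟩ := p
        have h' : a + b = k := by simpa [DiscreteConvolution.mem_addFiber] using h
        apply Subtype.ext
        simp [← h'] }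
  unfold convolve DiscreteConvolution.addConvolution
  rw [← e.tsum_eq]
  rfl

end

/-
Convolution with `u` followed by `Δ` acts on damped characters `k ↦ e^{iξk}` as approximate
multiplication by its symbol `(e^{iξ} - 1)² û(ξ)`, so its operator norm dominates
`(2 - 2 cos ξ) |û(ξ)|` for every `ξ`. Suppose that the norm is at most `4 / (n + 1)²` and compare
`û` with the Fejér kernel `F = (1 - cos ((n + 1) ξ)) / ((n + 1)² (1 - cos ξ))` at the nodes
`π j / (n + 1)`, `0 ≤ j < 2 (n + 1)`. At the even nodes `F` vanishes (or `û = F = 1`), so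
`F ≤ û` by positivity; at the odd nodes `(2 - 2 cos ξ) F = 4 / (n + 1)²`, so `|û| ≤ F`. By discrete
Fourier inversion the alternating sum of `û - F` over the nodes is a multiple of the coefficient at
`n + 1`, which is zero. Hence `û = F` at all nodes, and `u` is the triangle function. Conversely,
summation by parts shows that for the triangle function the operator is `(n + 1)⁻²` times a second
difference of translations with step `n + 1`, whose norm is at most `4`.
-/

open Asymptotics Filter Finset Topology
open scoped ENNReal

section NormedSpace

variable {𝕜 E F ι : Type*} [NontriviallyNormedField 𝕜]
  [NormedAddCommGroup E] [NormedSpace 𝕜 E] [NormedAddCommGroup F] [NormedSpace 𝕜 F]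

theorem iSup_ne_zero_norm_div_norm_eq_opNorm (T : E →L[𝕜] F) :
    ⨆ x : {x : E // x ≠ 0}, ‖T x‖ / ‖(x : E)‖ = ‖T‖ := by
  have hratio (x : {x : E // x ≠ 0}) : ‖T x‖ / ‖(x : E)‖ ≤ ‖T‖ := T.ratio_le_opNorm x
  refine le_antisymm (Real.iSup_le hratio (norm_nonneg T)) ?_
  refine T.opNorm_le_bound' (Real.iSup_nonneg fun x => by positivity) fun x hx => ?_
  rw [← div_le_iff₀ (lt_of_le_of_ne (norm_nonneg x) hx.symm)]
  exact le_ciSup (f := fun x : {x : E // x ≠ 0} => ‖T x‖ / ‖(x : E)‖)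
    ⟨‖T‖, Set.forall_mem_range.mpr hratio⟩ ⟨x, norm_ne_zero_iff.mp hx⟩

/-- The family `x` consists, along `l`, of approximate eigenvectors of `T` for the approximate
eigenvalue `c`: `‖T (x i) - c • x i‖ / ‖x i‖ → 0`. Since `c` need not be an eigenvalue, this gives
access to points of the continuous spectrum. -/
def IsApproxEigenfamily (T : E →L[𝕜] E) (c : 𝕜) (x : ι → E) (l : Filter ι) : Prop :=
  (fun i => T (x i) - c • x i) =o[l] x

namespace IsApproxEigenfamily

variable {T S : E →L[𝕜] E} {c d : 𝕜} {x : ι → E} {l : Filter ι}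

theorem one : IsApproxEigenfamily (1 : E →L[𝕜] E) 1 x l := by
  simp [IsApproxEigenfamily]

theorem sub (hT : IsApproxEigenfamily T c x l) (hS : IsApproxEigenfamily S d x l) :
    IsApproxEigenfamily (T - S) (c - d) x l :=
  (IsLittleO.sub hT hS).congr_left fun i => by
    simp only [sub_apply]
    module

theorem smul (a : 𝕜) (hT : IsApproxEigenfamily T c x l) :
    IsApproxEigenfamily (a • T) (a * c) x l :=
  (hT.const_smul_left a).congr_left fun i => by
    simp only [Pi.smul_apply, smul_apply]
    module

theorem sum {α : Type*} {s : Finset α} {T : α → E →L[𝕜] E} {c : α → 𝕜}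
    (hT : ∀ j ∈ s, IsApproxEigenfamily (T j) (c j) x l) :
    IsApproxEigenfamily (∑ j ∈ s, T j) (∑ j ∈ s, c j) x l :=
  (IsLittleO.sum hT).congr_left fun i => by
    simp only [_root_.sum_apply, Finset.sum_apply, sum_smul, sum_sub_distrib]

theorem mul (hT : IsApproxEigenfamily T c x l) (hS : IsApproxEigenfamily S d x l) :
    IsApproxEigenfamily (T * S) (c * d) x l :=
  (((T.isBigO_comp _ l).trans_isLittleO hS).add (hT.const_smul_left d)).congr_left fun i => by
    simp only [map_sub, map_smul, Pi.smul_apply, mul_apply_eq_comp]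
    module

theorem norm_le [l.NeBot] (hT : IsApproxEigenfamily T c x l) (hx : ∀ i, x i ≠ 0) :
    ‖c‖ ≤ ‖T‖ := by
  refine le_of_forall_pos_le_add fun ε hε => ?_
  obtain ⟨i, hi⟩ := (hT.bound hε).exists
  refine le_of_mul_le_mul_right ?_ (norm_pos_iff.mpr (hx i))
  calc ‖c‖ * ‖x i‖ = ‖T (x i) - (T (x i) - c • x i)‖ := by rw [sub_sub_cancel, norm_smul]
    _ ≤ ‖T (x i)‖ + ‖T (x i) - c • x i‖ := norm_sub_le _ _
    _ ≤ ‖T‖ * ‖x i‖ + ε * ‖x i‖ := add_le_add (T.le_opNorm _) hi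
    _ = (‖T‖ + ε) * ‖x i‖ := (add_mul _ _ _).symm

end IsApproxEigenfamily

end NormedSpace

section Translation

variable {G E : Type*} [AddGroup G] [NormedAddCommGroup E]

theorem memℓp_comp_equiv {α β : Type*} {p : ℝ≥0∞} {f : α → E} (hf : Memℓp f p) (e : β ≃ α) :
    Memℓp (f ∘ e) p := by
  obtain rfl | rfl | hp := p.trichotomy
  · exact memℓp_zero (hf.finite_dsupport.preimage e.injective.injOn)
  · exact memℓp_infty (hf.bddAbove.mono (Set.range_comp_subset_range e (fun a => ‖f a‖)))
  · exact memℓp_gen (e.summable_iff.mpr (hf.summable hp))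

variable (𝕜 : Type*) [NontriviallyNormedField 𝕜] [NormedSpace 𝕜 E]
  (p : ℝ≥0∞) [Fact (1 ≤ p)]

/-- The isometric translation operator `f ↦ f (· + m)` on `ℓᵖ(G, E)`. -/
noncomputable def lpTranslate (m : G) : lp (fun _ : G => E) p →ₗᵢ[𝕜] lp (fun _ : G => E) p where
  toFun f := ⟨fun k => f (k + m), memℓp_comp_equiv (lp.memℓp f) (Equiv.addRight m)⟩
  map_add' _ _ := rfl
  map_smul' _ _ := rfl
  norm_map' f := by
    obtain rfl | rfl | hp := p.trichotomy
    · exact absurd (Fact.out : (1 : ℝ≥0∞) ≤ 0) (by simp)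
    · exact (Equiv.addRight m).iSup_comp (g := fun k => ‖f k‖)
    · rw [lp.norm_eq_tsum_rpow hp, lp.norm_eq_tsum_rpow hp]
      congr 1
      exact (Equiv.addRight m).tsum_eq (fun k => ‖f k‖ ^ p.toReal)

theorem lpTranslate_mul (a b : G) :
    (lpTranslate 𝕜 p a).toContinuousLinearMap * (lpTranslate 𝕜 p b).toContinuousLinearMap =
      (lpTranslate (E := E) 𝕜 p (a + b)).toContinuousLinearMap := by
  ext f k
  exact congrArg f (add_assoc k a b)

end Translation

section DampedWave

theorem abs_exp_sub_one_le_exp_sub_one {x a : ℝ} (hx : |x| ≤ a) :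
    |Real.exp x - 1| ≤ Real.exp a - 1 := by
  obtain ⟨hleft, hright⟩ := abs_le.mp hx
  have hupper := Real.exp_le_exp.mpr hright
  have hlower := Real.exp_le_exp.mpr hleft
  rw [abs_le]
  constructor <;> linarith [Real.add_one_le_exp a, Real.add_one_le_exp (-a)]

theorem abs_exp_neg_abs_mul_sub_le (x y : ℝ) {t : ℝ} (ht : 0 ≤ t) :
    |Real.exp (-(|x + y| * t)) - Real.exp (-(|x| * t))| ≤
      (Real.exp (|y| * t) - 1) * Real.exp (-(|x| * t)) := by
  have hexponent : |(|x| - |x + y|) * t| ≤ |y| * t := by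
    rw [abs_mul, abs_of_nonneg ht]
    have habs := abs_abs_sub_abs_le x (x + y)
    rw [sub_add_cancel_left, abs_neg] at habs
    exact mul_le_mul_of_nonneg_right habs ht
  have hfactor : Real.exp (-(|x + y| * t)) - Real.exp (-(|x| * t)) =
      (Real.exp ((|x| - |x + y|) * t) - 1) * Real.exp (-(|x| * t)) := by
    rw [sub_mul, ← Real.exp_add]
    ring_nf
  rw [hfactor, abs_mul, Real.abs_exp]
  gcongr
  exact abs_exp_sub_one_le_exp_sub_one hexponent

theorem summable_exp_neg_abs_mul {t : ℝ} (ht : 0 < t) :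
    Summable fun k : ℤ => Real.exp (-(|(k : ℝ)| * t)) := by
  have h : Summable fun k : ℕ => Real.exp (k * -t) :=
    Real.summable_exp_nat_mul_iff.mpr (neg_lt_zero.mpr ht)
  apply Summable.of_nat_of_neg <;> simpa using h

variable (p : ℝ≥0∞) [Fact (1 ≤ p)] (z : Circle)

/-- The character `k ↦ zᵏ` damped by `e^{-|k|/(L+1)}` so as to lie in `ℓᵖ(ℤ)`. As `L → ∞` these
are approximate eigenvectors of all translations; exponential damping serves every `p`, including
`p = ∞`. -/
noncomputable def dampedWave (L : ℕ) : lp (fun _ : ℤ => ℂ) p :=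
  ⟨fun k => Real.exp (-(|(k : ℝ)| * (1 / ((L : ℝ) + 1)))) • ((z ^ k : Circle) : ℂ), by
    refine Memℓp.of_exponent_ge (memℓp_gen ?_) (Fact.out : 1 ≤ p)
    simp only [ENNReal.toReal_one, Real.rpow_one, norm_smul, Circle.norm_coe, mul_one,
      Real.norm_of_nonneg (Real.exp_nonneg _)]
    exact summable_exp_neg_abs_mul (by positivity)⟩

theorem dampedWave_apply (L : ℕ) (k : ℤ) :
    dampedWave p z L k =
      Real.exp (-(|(k : ℝ)| * (1 / ((L : ℝ) + 1)))) • ((z ^ k : Circle) : ℂ) :=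
  rfl

theorem norm_dampedWave_apply (L : ℕ) (k : ℤ) :
    ‖dampedWave p z L k‖ = Real.exp (-(|(k : ℝ)| * (1 / ((L : ℝ) + 1)))) := by
  rw [dampedWave_apply, norm_smul, Circle.norm_coe, mul_one,
    Real.norm_of_nonneg (Real.exp_nonneg _)]

theorem dampedWave_ne_zero (L : ℕ) : dampedWave p z L ≠ 0 := by
  intro h
  have h0 := norm_dampedWave_apply p z L 0
  simp [h] at h0

theorem norm_lpTranslate_dampedWave_sub_le (m : ℤ) (L : ℕ) :
    ‖lpTranslate ℂ p m (dampedWave p z L) - ((z ^ m : Circle) : ℂ) • dampedWave p z L‖ ≤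
      (Real.exp (|(m : ℝ)| * (1 / ((L : ℝ) + 1))) - 1) * ‖dampedWave p z L‖ := by
  set t : ℝ := 1 / ((L : ℝ) + 1) with ht
  set C : ℝ := Real.exp (|(m : ℝ)| * t) - 1
  have ht0 : 0 ≤ t := by positivity
  have hC : ‖(C : ℂ)‖ = C :=
    Complex.norm_of_nonneg (sub_nonneg.mpr (Real.one_le_exp (by positivity)))
  have hpointwise (k : ℤ) :
      ‖dampedWave p z L (k + m) - ((z ^ m : Circle) : ℂ) * dampedWave p z L k‖ ≤
        C * ‖dampedWave p z L k‖ := by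
    have hfactor : dampedWave p z L (k + m) - ((z ^ m : Circle) : ℂ) * dampedWave p z L k =
        (Real.exp (-(|(k : ℝ) + m| * t)) - Real.exp (-(|(k : ℝ)| * t))) •
          ((z ^ (k + m) : Circle) : ℂ) := by
      rw [dampedWave_apply, dampedWave_apply, ← ht, zpow_add, Circle.coe_mul, Int.cast_add,
        sub_smul, mul_smul_comm, mul_comm ((z ^ m : Circle) : ℂ)]
    rw [hfactor, norm_smul, Circle.norm_coe, mul_one, norm_dampedWave_apply]
    exact abs_exp_neg_abs_mul_sub_le _ _ ht0
  rw [← hC, ← norm_smul]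
  refine lp.norm_mono (zero_lt_one.trans_le Fact.out).ne' fun k => ?_
  rw [lp.coeFn_smul, Pi.smul_apply, norm_smul, hC]
  exact hpointwise k

theorem isApproxEigenfamily_lpTranslate (m : ℤ) :
    IsApproxEigenfamily (lpTranslate ℂ p m).toContinuousLinearMap ((z ^ m : Circle) : ℂ)
      (dampedWave p z) atTop := by
  have hlim : Tendsto (fun L : ℕ => Real.exp (|(m : ℝ)| * (1 / ((L : ℝ) + 1))) - 1) atTop
      (𝓝 0) := by
    simpa using ((tendsto_one_div_add_atTop_nhds_zero_nat (𝕜 := ℝ)).const_mul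
      |(m : ℝ)|).rexp.sub_const 1
  refine isLittleO_iff.mpr fun ε hε => ?_
  filter_upwards [hlim.eventually_le_const hε] with L hL
  exact (norm_lpTranslate_dampedWave_sub_le p z m L).trans (by gcongr)

end DampedWave

section Convolution

variable {s : Finset ℤ} {u : ℤ → ℝ}

theorem convolve_eq_sum (f : ℤ → ℂ) (hu : ∀ k ∉ s, u k = 0) (k : ℤ) :
    convolve f u k = ∑ j ∈ s, (u j : ℂ) * f (k - j) := by
  rw [convolve_apply, tsum_eq_sum fun j hj => by rw [hu j hj, Complex.ofReal_zero, mul_zero]]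
  exact sum_congr rfl fun j _ => mul_comm _ _

theorem fourierSeries_eq_sum (hu : ∀ k ∉ s, u k = 0) (ξ : ℝ) :
    fourierSeries u ξ = ∑ k ∈ s, (u k : ℂ) * ((Circle.exp ξ ^ (-k) : Circle) : ℂ) := by
  rw [fourierSeries, tsum_eq_sum fun k hk => by rw [hu k hk, Complex.ofReal_zero, zero_mul]]
  refine sum_congr rfl fun k _ => ?_
  rw [Circle.coe_zpow, Circle.coe_exp, ← Complex.exp_int_mul]
  congr 2
  push_cast
  ring

variable (p : ℝ≥0∞) [Fact (1 ≤ p)]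

/-- The operator `f ↦ Δ f` on `ℓᵖ(ℤ)`. -/
noncomputable def lpLaplacian : lp (fun _ : ℤ => ℂ) p →L[ℂ] lp (fun _ : ℤ => ℂ) p :=
  ((lpTranslate ℂ p 1).toContinuousLinearMap - 1) * ((lpTranslate ℂ p 1).toContinuousLinearMap - 1)

variable (s u) in
/-- The operator `f ↦ f * u` on `ℓᵖ(ℤ)`, for a kernel `u` supported in the finite set `s`. -/
noncomputable def lpConvolve : lp (fun _ : ℤ => ℂ) p →L[ℂ] lp (fun _ : ℤ => ℂ) p :=
  ∑ j ∈ s, (u j : ℂ) • (lpTranslate ℂ p (-j)).toContinuousLinearMap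

theorem coe_lpLaplacian (f : lp (fun _ : ℤ => ℂ) p) :
    ⇑(lpLaplacian p f) = discreteLaplacian f := by
  rw [discreteLaplacian_eq_fwdDiff]
  rfl

theorem coe_lpConvolve (hu : ∀ k ∉ s, u k = 0) (f : lp (fun _ : ℤ => ℂ) p) :
    ⇑(lpConvolve s u p f) = convolve f u := by
  ext k
  rw [convolve_eq_sum _ hu, lpConvolve, _root_.sum_apply, lp.coeFn_sum, Finset.sum_apply]
  rfl

theorem isApproxEigenfamily_lpLaplacian (z : Circle) :
    IsApproxEigenfamily (lpLaplacian p) (((z : ℂ) - 1) * (z - 1)) (dampedWave p z) atTop := by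
  have h := (isApproxEigenfamily_lpTranslate p z 1).sub .one
  rw [zpow_one] at h
  exact h.mul h

theorem isApproxEigenfamily_lpConvolve (hu : ∀ k ∉ s, u k = 0) (ξ : ℝ) :
    IsApproxEigenfamily (lpConvolve s u p) (fourierSeries u ξ) (dampedWave p (Circle.exp ξ))
      atTop := by
  rw [fourierSeries_eq_sum hu]
  exact .sum fun j _ => (isApproxEigenfamily_lpTranslate p _ (-j)).smul (u j : ℂ)

theorem norm_circleExp_sub_one_sq (ξ : ℝ) :
    ‖(Circle.exp ξ : ℂ) - 1‖ ^ 2 = 2 - 2 * Real.cos ξ := by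
  rw [Circle.coe_exp, mul_comm, Complex.norm_exp_I_mul_ofReal_sub_one, norm_mul, mul_pow,
    Real.norm_eq_abs, Real.norm_eq_abs, sq_abs, sq_abs, Real.sin_sq_eq_half_sub, mul_div_cancel₀]
  · ring
  · norm_num

theorem mul_norm_fourierSeries_le_norm_lpLaplacian_mul_lpConvolve (hu : ∀ k ∉ s, u k = 0)
    (ξ : ℝ) :
    (2 - 2 * Real.cos ξ) * ‖fourierSeries u ξ‖ ≤ ‖lpLaplacian p * lpConvolve s u p‖ := by
  have h := ((isApproxEigenfamily_lpLaplacian p (Circle.exp ξ)).mul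
    (isApproxEigenfamily_lpConvolve p hu ξ)).norm_le (dampedWave_ne_zero p _)
  rwa [norm_mul, norm_mul, ← sq, norm_circleExp_sub_one_sq] at h

end Convolution

section Triangle

theorem sum_Icc_neg_secondDiff {M : Type*} [AddCommGroup M] (g : ℤ → M) (n : ℕ) :
    ∑ k ∈ Icc (-n : ℤ) n, (g (k + 1) - 2 • g k + g (k - 1)) =
      g (n + 1) - g n - g (-n) + g (-(n + 1)) := by
  induction n with
  | zero =>
    simp only [Nat.cast_zero, neg_zero, Icc_self, sum_singleton, zero_add, zero_sub]
    abel
  | succ n ih =>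
    rw [Nat.cast_succ, sum_Icc_succ_eq_add_endpoints, ih, add_sub_cancel_right,
      show -((n : ℤ) + 1) + 1 = -n by ring, show -((n : ℤ) + 1) - 1 = -(n + 1 + 1) by ring]
    abel

theorem sum_Icc_neg_hat_zsmul_secondDiff {M : Type*} [AddCommGroup M] (g : ℤ → M) (n : ℕ) :
    ∑ k ∈ Icc (-n : ℤ) n, ((n : ℤ) + 1 - |k|) • (g (k + 1) - 2 • g k + g (k - 1)) =
      g (n + 1) - 2 • g 0 + g (-(n + 1)) := by
  induction n with
  | zero => simp
  | succ n ih =>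
    have habs : |(n : ℤ) + 1| = n + 1 := abs_of_nonneg (by positivity)
    have hsum := sum_Icc_neg_secondDiff g (n + 1)
    have hstep (k : ℤ) (x : M) : ((n : ℤ) + 1 + 1 - |k|) • x = ((n : ℤ) + 1 - |k|) • x + x := by
      module
    rw [Nat.cast_succ] at hsum ⊢
    simp only [hstep]
    rw [sum_add_distrib, hsum, sum_Icc_succ_eq_add_endpoints, ih, abs_neg, habs, sub_self,
      zero_smul, zero_smul]
    abel

theorem triangle_eq_zero_of_notMem_Icc {n : ℕ} {k : ℤ} (hk : k ∉ Icc (-n : ℤ) n) :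
    triangle n k = 0 := by
  rw [mem_Icc, ← abs_le] at hk
  exact if_neg hk

theorem sum_triangle_smul_secondDiff {M : Type*} [AddCommGroup M] [Module ℂ M] (g : ℤ → M)
    (n : ℕ) :
    ∑ k ∈ Icc (-n : ℤ) n, (triangle n k : ℂ) • (g (k + 1) - 2 • g k + g (k - 1)) =
      (((n : ℂ) + 1) ^ 2)⁻¹ • (g (n + 1) - 2 • g 0 + g (-(n + 1))) := by
  rw [← sum_Icc_neg_hat_zsmul_secondDiff, smul_sum]
  refine sum_congr rfl fun k hk => ?_
  rw [mem_Icc, ← abs_le] at hk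
  rw [triangle, if_pos hk, ← Int.cast_smul_eq_zsmul ℂ, smul_smul, ← Int.cast_abs, div_eq_inv_mul]
  push_cast [-Int.cast_abs]
  rfl

theorem sum_triangle (n : ℕ) : ∑ k ∈ Icc (-n : ℤ) n, triangle n k = 1 := by
  have hsum := sum_triangle_smul_secondDiff (fun k => (k : ℂ) ^ 2) n
  have hdiff (k : ℤ) : ((k + 1 : ℤ) : ℂ) ^ 2 - 2 • (k : ℂ) ^ 2 + ((k - 1 : ℤ) : ℂ) ^ 2 = 2 := by
    push_cast
    ring
  have hends : ((n + 1 : ℤ) : ℂ) ^ 2 - 2 • ((0 : ℤ) : ℂ) ^ 2 + ((-(n + 1) : ℤ) : ℂ) ^ 2 =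
      ((n : ℂ) + 1) ^ 2 * 2 := by
    push_cast
    ring
  have hn : ((n : ℂ) + 1) ^ 2 ≠ 0 := pow_ne_zero 2 (Nat.cast_add_one_ne_zero n)
  simp only [hdiff, hends, smul_eq_mul, inv_mul_cancel_left₀ hn, ← sum_mul] at hsum
  exact_mod_cast mul_right_cancel₀ two_ne_zero (hsum.trans (one_mul 2).symm)

theorem circleExp_zpow_add_zpow_neg (ξ : ℝ) (k : ℤ) :
    ((Circle.exp ξ ^ k : Circle) : ℂ) + ((Circle.exp ξ ^ (-k) : Circle) : ℂ) =
      (2 * Real.cos (k * ξ) : ℝ) := by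
  rw [← Circle.exp_intCast_mul, ← Circle.exp_intCast_mul, Circle.coe_exp, Circle.coe_exp]
  push_cast
  rw [Complex.two_cos, neg_mul]

theorem circleExp_zpow_secondDiff (ξ : ℝ) (k : ℤ) :
    ((Circle.exp ξ ^ (-(k + 1)) : Circle) : ℂ) - 2 • ((Circle.exp ξ ^ (-k) : Circle) : ℂ) +
        ((Circle.exp ξ ^ (-(k - 1)) : Circle) : ℂ) =
      -((2 - 2 * Real.cos ξ : ℝ) : ℂ) * ((Circle.exp ξ ^ (-k) : Circle) : ℂ) := by
  have h := circleExp_zpow_add_zpow_neg ξ 1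
  rw [Int.cast_one, one_mul] at h
  rw [show -(k + 1) = -1 + -k by ring, show -(k - 1) = 1 + -k by ring, zpow_add, zpow_add,
    Circle.coe_mul, Circle.coe_mul, Complex.ofReal_sub, ← h, nsmul_eq_mul]
  push_cast
  ring

theorem mul_fourierSeries_triangle (n : ℕ) (ξ : ℝ) :
    ((2 - 2 * Real.cos ξ : ℝ) : ℂ) * fourierSeries (triangle n) ξ =
      ((2 - 2 * Real.cos (((n : ℝ) + 1) * ξ)) / ((n : ℝ) + 1) ^ 2 : ℝ) := by
  have hsum := sum_triangle_smul_secondDiff (fun k => ((Circle.exp ξ ^ (-k) : Circle) : ℂ)) n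
  have hends := circleExp_zpow_add_zpow_neg ξ (n + 1)
  simp only [circleExp_zpow_secondDiff, smul_eq_mul, mul_left_comm _ (-_ : ℂ), ← mul_sum] at hsum
  rw [← fourierSeries_eq_sum fun _ => triangle_eq_zero_of_notMem_Icc, neg_neg, neg_zero, zpow_zero,
    sub_add_eq_add_sub, add_comm ((_ : Circle) : ℂ), hends, Circle.coe_one] at hsum
  rw [← neg_inj, ← neg_mul, hsum]
  push_cast
  ring

theorem fourierSeries_of_cos_eq_one {s : Finset ℤ} {u : ℤ → ℝ} (hu : ∀ k ∉ s, u k = 0) {ξ : ℝ}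
    (hξ : Real.cos ξ = 1) : fourierSeries u ξ = ((∑ k ∈ s, u k : ℝ) : ℂ) := by
  obtain ⟨m, rfl⟩ := (Real.cos_eq_one_iff ξ).mp hξ
  rw [fourierSeries_eq_sum hu, Circle.exp_int_mul_two_pi]
  simp only [one_zpow, Circle.coe_one, mul_one, Complex.ofReal_sum]

theorem fourierSeries_triangle (n : ℕ) (ξ : ℝ) :
    fourierSeries (triangle n) ξ = (normalizedFejer n ξ : ℂ) := by
  unfold normalizedFejer
  split_ifs with hξ
  · rw [fourierSeries_of_cos_eq_one (fun _ => triangle_eq_zero_of_notMem_Icc) hξ, sum_triangle]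
  · have h : (2 - 2 * Real.cos ξ : ℝ) ≠ 0 := fun h => hξ (by linarith)
    refine mul_left_cancel₀ (Complex.ofReal_ne_zero.mpr h) ?_
    rw [mul_fourierSeries_triangle, ← Complex.ofReal_mul]
    congr 1
    have : 1 - Real.cos ξ ≠ 0 := fun h => hξ (by linarith)
    field_simp

theorem mul_normalizedFejer (n : ℕ) (ξ : ℝ) :
    (2 - 2 * Real.cos ξ) * normalizedFejer n ξ =
      (2 - 2 * Real.cos (((n : ℝ) + 1) * ξ)) / ((n : ℝ) + 1) ^ 2 := by
  have h := mul_fourierSeries_triangle n ξ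
  rw [fourierSeries_triangle] at h
  exact_mod_cast h

end Triangle

section TriangleOperator

variable (p : ℝ≥0∞) [Fact (1 ≤ p)]

-- The indices are shaped for summation by parts with `g j` the translation by `1 - j`.
theorem lpLaplacian_mul_lpTranslate_neg (j : ℤ) :
    lpLaplacian p * (lpTranslate ℂ p (-j)).toContinuousLinearMap =
      (lpTranslate ℂ p (1 - (j + 1))).toContinuousLinearMap -
        2 • (lpTranslate ℂ p (1 - j)).toContinuousLinearMap +
        (lpTranslate ℂ p (1 - (j - 1))).toContinuousLinearMap := by
  rw [show 1 - (j + 1) = -j by ring, show 1 - j = 1 + -j by ring,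
    show 1 - (j - 1) = 1 + (1 + -j) by ring, ← lpTranslate_mul ℂ p 1 (1 + -j),
    ← lpTranslate_mul ℂ p 1 (-j), lpLaplacian]
  noncomm_ring

theorem lpLaplacian_mul_lpConvolve_triangle (n : ℕ) :
    lpLaplacian p * lpConvolve (Icc (-n : ℤ) n) (triangle n) p =
      (((n : ℂ) + 1) ^ 2)⁻¹ • ((lpTranslate ℂ p (-n : ℤ)).toContinuousLinearMap -
        2 • (lpTranslate ℂ p 1).toContinuousLinearMap +
        (lpTranslate ℂ p (n + 2 : ℤ)).toContinuousLinearMap) := by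
  have h := sum_triangle_smul_secondDiff
    (fun j => (lpTranslate (E := ℂ) ℂ p (1 - j)).toContinuousLinearMap) n
  rw [show 1 - ((n : ℤ) + 1) = -n by ring, sub_zero,
    show 1 - -((n : ℤ) + 1) = n + 2 by ring] at h
  rw [← h, lpConvolve, mul_sum]
  exact sum_congr rfl fun j _ => by rw [mul_smul_comm, lpLaplacian_mul_lpTranslate_neg]

theorem norm_lpLaplacian_mul_lpConvolve_triangle_le (n : ℕ) :
    ‖lpLaplacian p * lpConvolve (Icc (-n : ℤ) n) (triangle n) p‖ ≤ 4 / ((n : ℝ) + 1) ^ 2 := by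
  have hτ (m : ℤ) : ‖(lpTranslate (E := ℂ) ℂ p m).toContinuousLinearMap‖ ≤ 1 :=
    LinearIsometry.norm_toContinuousLinearMap_le _
  rw [lpLaplacian_mul_lpConvolve_triangle, norm_smul, norm_inv, norm_pow, ← Nat.cast_add_one,
    Complex.norm_natCast, Nat.cast_add_one, inv_mul_eq_div]
  gcongr
  calc _ ≤ 1 + 2 * 1 + 1 := norm_add_le_of_le (norm_sub_le_of_le (hτ _)
          (norm_nsmul_le.trans (by gcongr; exacts [le_rfl, hτ _]))) (hτ _)
    _ = 4 := by norm_num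

theorem norm_lpLaplacian_mul_lpConvolve_triangle (n : ℕ) :
    ‖lpLaplacian p * lpConvolve (Icc (-n : ℤ) n) (triangle n) p‖ = 4 / ((n : ℝ) + 1) ^ 2 := by
  refine le_antisymm (norm_lpLaplacian_mul_lpConvolve_triangle_le p n) ?_
  have hn : (n : ℝ) + 1 ≠ 0 := Nat.cast_add_one_ne_zero n
  have hcos : 0 ≤ 2 - 2 * Real.cos (Real.pi / (n + 1)) := by
    linarith [Real.cos_le_one (Real.pi / (n + 1))]
  calc 4 / ((n : ℝ) + 1) ^ 2
      = (2 - 2 * Real.cos (Real.pi / (n + 1))) * normalizedFejer n (Real.pi / (n + 1)) := by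
        rw [mul_normalizedFejer, mul_div_cancel₀ _ hn, Real.cos_pi]
        norm_num
    _ ≤ (2 - 2 * Real.cos (Real.pi / (n + 1))) *
          ‖fourierSeries (triangle n) (Real.pi / (n + 1))‖ := by
        rw [fourierSeries_triangle, Complex.norm_real]
        exact mul_le_mul_of_nonneg_left (Real.le_norm_self _) hcos
    _ ≤ _ := mul_norm_fourierSeries_le_norm_lpLaplacian_mul_lpConvolve p
        (fun _ => triangle_eq_zero_of_notMem_Icc) _

end TriangleOperator

section Sampling

theorem sum_range_zpow_pow_of_isPrimitiveRoot {K : Type*} [Field K] {ζ : K} {N : ℕ}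
    (hζ : IsPrimitiveRoot ζ N) (m : ℤ) :
    ∑ j ∈ range N, (ζ ^ m) ^ j = if (N : ℤ) ∣ m then (N : K) else 0 := by
  split_ifs with hm
  · simp [hζ.zpow_eq_one_iff_dvd m |>.mpr hm]
  · have hpow : (ζ ^ m) ^ N = 1 := by
      rw [← zpow_natCast, zpow_comm, zpow_natCast, hζ.pow_eq_one, one_zpow]
    rw [geom_sum_eq (mt (hζ.zpow_eq_one_iff_dvd m).mp hm), hpow, sub_self, zero_div]

theorem isPrimitiveRoot_circleExp {N : ℕ} {x : ℝ} (hx : N * x = 2 * Real.pi) :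
    IsPrimitiveRoot (Circle.exp x : ℂ) N := by
  have hN : N ≠ 0 := by
    rintro rfl
    simp [Real.pi_ne_zero] at hx
  have hx' : 2 * (Real.pi : ℂ) = N * x := by exact_mod_cast hx.symm
  convert Complex.isPrimitiveRoot_exp N hN
  rw [Circle.coe_exp, hx']
  field_simp

variable {N : ℕ} {x : ℝ} {s : Finset ℤ} {u v : ℤ → ℝ}

theorem sum_circleExp_zpow_mul_fourierSeries (hx : N * x = 2 * Real.pi)
    (hu : ∀ k ∉ s, u k = 0) {l : ℤ} (hl : ∀ k ∈ s, (N : ℤ) ∣ l - k → k = l) :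
    ∑ j ∈ range N, ((Circle.exp x : ℂ) ^ l) ^ j * fourierSeries u (j * x) = N * (u l : ℂ) := by
  have hterm (j : ℕ) : ((Circle.exp x : ℂ) ^ l) ^ j * fourierSeries u (j * x) =
      ∑ k ∈ s, (u k : ℂ) * ((Circle.exp x : ℂ) ^ (l - k)) ^ j := by
    rw [fourierSeries_eq_sum hu, mul_sum]
    refine sum_congr rfl fun k _ => ?_
    rw [Circle.exp_natCast_mul, Circle.coe_zpow, Circle.coe_pow, sub_eq_add_neg,
      zpow_add₀ (Circle.coe_ne_zero _), mul_pow, ← zpow_natCast _ j, ← zpow_natCast _ j,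
      ← zpow_natCast _ j, zpow_comm _ (j : ℤ) (-k)]
    ring
  have horth : ∀ k ∈ s, (u k : ℂ) * ∑ j ∈ range N, ((Circle.exp x : ℂ) ^ (l - k)) ^ j =
      if k = l then (u k : ℂ) * N else 0 := by
    intro k hk
    have hdvd : (N : ℤ) ∣ l - k ↔ k = l := ⟨hl k hk, by rintro rfl; simp⟩
    rw [sum_range_zpow_pow_of_isPrimitiveRoot (isPrimitiveRoot_circleExp hx), if_congr hdvd rfl rfl,
      mul_ite, mul_zero]
  simp only [hterm]
  rw [sum_comm]
  simp only [← mul_sum]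
  rw [sum_congr rfl horth, sum_ite_eq', mul_comm]
  split_ifs with hls
  · rfl
  · rw [hu l hls, Complex.ofReal_zero, mul_zero]

theorem eq_of_fourierSeries_eq (hx : N * x = 2 * Real.pi) (hu : ∀ k ∉ s, u k = 0)
    (hv : ∀ k ∉ s, v k = 0) (hs : ∀ k ∈ s, ∀ l ∈ s, (N : ℤ) ∣ l - k → k = l)
    (huv : ∀ j < N, fourierSeries u (j * x) = fourierSeries v (j * x)) : u = v := by
  have hN : N ≠ 0 := by
    rintro rfl
    simp [Real.pi_ne_zero] at hx
  funext l
  by_cases hl : l ∈ s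
  · have hul := sum_circleExp_zpow_mul_fourierSeries hx hu fun k hk => hs k hk l hl
    have hvl := sum_circleExp_zpow_mul_fourierSeries hx hv fun k hk => hs k hk l hl
    rw [sum_congr rfl fun j hj => by rw [huv j (mem_range.mp hj)], hvl] at hul
    exact_mod_cast (mul_left_cancel₀ (Nat.cast_ne_zero.mpr hN) hul).symm
  · rw [hu l hl, hv l hl]

end Sampling

section Extremal

variable {n : ℕ} {u v : ℤ → ℝ}

theorem two_mul_succ_mul_pi_div_succ (n : ℕ) :
    ((2 * (n + 1) : ℕ) : ℝ) * (Real.pi / (n + 1)) = 2 * Real.pi := by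
  push_cast
  rw [mul_assoc, mul_div_cancel₀ _ (Nat.cast_add_one_ne_zero n)]

theorem cos_succ_mul_mul_pi_div_succ (n j : ℕ) :
    Real.cos (((n : ℝ) + 1) * (j * (Real.pi / (n + 1)))) = (-1) ^ j := by
  rw [mul_left_comm, mul_div_cancel₀ _ (Nat.cast_add_one_ne_zero n), Real.cos_nat_mul_pi]

theorem eq_of_dvd_sub_of_mem_Icc {k l : ℤ} (hk : k ∈ Icc (-n : ℤ) n)
    (hl : l ∈ Icc (-n : ℤ) (n + 1)) (hdvd : ((2 * (n + 1) : ℕ) : ℤ) ∣ l - k) : k = l := by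
  rw [mem_Icc] at hk hl
  have h := Int.eq_zero_of_abs_lt_dvd hdvd (by rw [abs_lt]; push_cast; omega)
  omega

theorem sum_neg_one_pow_mul_fourierSeries (hu : ∀ k ∉ Icc (-n : ℤ) n, u k = 0) :
    ∑ j ∈ range (2 * (n + 1)), (-1) ^ j * fourierSeries u (j * (Real.pi / (n + 1))) = 0 := by
  have h := sum_circleExp_zpow_mul_fourierSeries (two_mul_succ_mul_pi_div_succ n) hu (l := n + 1)
    fun k hk => eq_of_dvd_sub_of_mem_Icc hk (mem_Icc.mpr ⟨by omega, le_rfl⟩)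
  have hroot : (Circle.exp (Real.pi / (n + 1)) : ℂ) ^ ((n : ℤ) + 1) = -1 := by
    have hπ : ((n + 1 : ℤ) : ℝ) * (Real.pi / (n + 1)) = Real.pi := by
      push_cast
      exact mul_div_cancel₀ _ (Nat.cast_add_one_ne_zero n)
    rw [← Circle.coe_zpow, ← Circle.exp_intCast_mul, hπ, Circle.coe_exp, Complex.exp_pi_mul_I]
  rwa [hroot, hu (n + 1) (by simp), Complex.ofReal_zero, mul_zero] at h

theorem re_fourierSeries_eq_of_alternating (hu : ∀ k ∉ Icc (-n : ℤ) n, u k = 0)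
    (hv : ∀ k ∉ Icc (-n : ℤ) n, v k = 0)
    (huv : ∀ j : ℕ, 0 ≤ (-1) ^ j * ((fourierSeries u (j * (Real.pi / (n + 1)))).re -
      (fourierSeries v (j * (Real.pi / (n + 1)))).re)) {j : ℕ} (hj : j < 2 * (n + 1)) :
    (fourierSeries u (j * (Real.pi / (n + 1)))).re =
      (fourierSeries v (j * (Real.pi / (n + 1)))).re := by
  have hre (w : ℤ → ℝ) (hw : ∀ k ∉ Icc (-n : ℤ) n, w k = 0) : ∑ j ∈ range (2 * (n + 1)),
      (-1) ^ j * (fourierSeries w (j * (Real.pi / (n + 1)))).re = 0 := by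
    rw [← Complex.zero_re, ← sum_neg_one_pow_mul_fourierSeries hw, Complex.re_sum]
    refine sum_congr rfl fun j _ => ?_
    rw [← Complex.re_ofReal_mul]
    norm_num
  have hsum : ∑ j ∈ range (2 * (n + 1)), (-1) ^ j *
      ((fourierSeries u (j * (Real.pi / (n + 1)))).re -
        (fourierSeries v (j * (Real.pi / (n + 1)))).re) = 0 := by
    simp only [mul_sub, sum_sub_distrib, hre u hu, hre v hv, sub_self]
  have hterm := (sum_eq_zero_iff_of_nonneg fun j _ => huv j).mp hsum j (mem_range.mpr hj)
  exact sub_eq_zero.mp ((mul_eq_zero.mp hterm).resolve_left (pow_ne_zero j (by norm_num)))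

theorem normalizedFejer_le_fourierSeries {ξ : ℝ} (hu : ∀ k ∉ Icc (-n : ℤ) n, u k = 0)
    (hsum : ∑ k ∈ Icc (-n : ℤ) n, u k = 1) (hξ : Real.cos (((n : ℝ) + 1) * ξ) = 1)
    (hpos : 0 ≤ fourierSeries u ξ) : (normalizedFejer n ξ : ℂ) ≤ fourierSeries u ξ := by
  by_cases h : Real.cos ξ = 1
  · rw [fourierSeries_of_cos_eq_one hu h, hsum, normalizedFejer, if_pos h]
  · rwa [normalizedFejer, if_neg h, hξ, sub_self, zero_div, mul_zero, Complex.ofReal_zero]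

theorem norm_fourierSeries_le_normalizedFejer {ξ : ℝ} (hξ : Real.cos (((n : ℝ) + 1) * ξ) = -1)
    (hle : (2 - 2 * Real.cos ξ) * ‖fourierSeries u ξ‖ ≤ 4 / ((n : ℝ) + 1) ^ 2) :
    ‖fourierSeries u ξ‖ ≤ normalizedFejer n ξ := by
  have hF := mul_normalizedFejer n ξ
  have hnorm : (2 - 2 * Real.cos ξ) * normalizedFejer n ξ = 4 / ((n : ℝ) + 1) ^ 2 := by
    rw [hF, hξ]
    norm_num
  have hcos : 0 < 2 - 2 * Real.cos ξ := by
    refine lt_of_le_of_ne (by linarith [Real.cos_le_one ξ]) fun h => ?_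
    rw [← h, zero_mul] at hnorm
    exact absurd hnorm (by positivity)
  exact le_of_mul_le_mul_left (hle.trans_eq hnorm.symm) hcos

theorem eq_triangle_of_symbol_le (hu : ∀ k ∉ Icc (-n : ℤ) n, u k = 0)
    (hsum : ∑ k ∈ Icc (-n : ℤ) n, u k = 1)
    (hpos : ∀ j : ℕ, Even j → 0 ≤ fourierSeries u (j * (Real.pi / (n + 1))))
    (hle : ∀ ξ, (2 - 2 * Real.cos ξ) * ‖fourierSeries u ξ‖ ≤ 4 / ((n : ℝ) + 1) ^ 2) :
    u = triangle n := by
  have htri : ∀ k ∉ Icc (-n : ℤ) n, triangle n k = 0 := fun _ => triangle_eq_zero_of_notMem_Icc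
  set x : ℕ → ℝ := fun j => j * (Real.pi / (n + 1))
  have heven {j : ℕ} (hj : Even j) : (normalizedFejer n (x j) : ℂ) ≤ fourierSeries u (x j) :=
    normalizedFejer_le_fourierSeries hu hsum
      ((cos_succ_mul_mul_pi_div_succ n j).trans hj.neg_one_pow) (hpos j hj)
  have hodd {j : ℕ} (hj : Odd j) : ‖fourierSeries u (x j)‖ ≤ normalizedFejer n (x j) :=
    norm_fourierSeries_le_normalizedFejer
      ((cos_succ_mul_mul_pi_div_succ n j).trans hj.neg_one_pow) (hle _)
  have hsign (j : ℕ) :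
      0 ≤ (-1) ^ j * ((fourierSeries u (x j)).re - (fourierSeries (triangle n) (x j)).re) := by
    rw [fourierSeries_triangle, Complex.ofReal_re]
    rcases j.even_or_odd with hj | hj
    · rw [hj.neg_one_pow, one_mul, sub_nonneg]
      exact (Complex.le_def.mp (heven hj)).1
    · rw [hj.neg_one_pow, neg_one_mul, neg_sub, sub_nonneg]
      exact (Complex.re_le_norm _).trans (hodd hj)
  refine eq_of_fourierSeries_eq (two_mul_succ_mul_pi_div_succ n) hu htri
    (fun k hk l hl => eq_of_dvd_sub_of_mem_Icc hk (Icc_subset_Icc_right (by omega) hl))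
    fun j hj => ?_
  have hre := re_fourierSeries_eq_of_alternating hu htri hsign hj
  refine Complex.ext hre ?_
  rw [fourierSeries_triangle, Complex.ofReal_re] at hre
  rw [fourierSeries_triangle, Complex.ofReal_im]
  rcases j.even_or_odd with hj | hj
  · exact (Complex.le_def.mp (heven hj)).2.symm
  · have hnorm := (Complex.re_le_norm _).antisymm ((hodd hj).trans_eq hre.symm)
    exact (Complex.le_def.mp (Complex.re_eq_norm.mp hnorm)).2.symm

end Extremal

theorem theorem2_general (p : ℝ≥0∞) [Fact (1 ≤ p)] {n : ℕ} {u : ℤ → ℝ}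
    (hu : ∀ k : ℤ, (n : ℤ) < |k| → u k = 0) (hsum : ∑ k ∈ Icc (-n : ℤ) n, u k = 1)
    (hpos : ∀ j : ℕ, 0 ≤ fourierSeries u (2 * Real.pi * j / (n + 1))) :
    ∃ T : lp (fun _ : ℤ => ℂ) p →L[ℂ] lp (fun _ : ℤ => ℂ) p,
      (∀ f, (T f : ℤ → ℂ) = discreteLaplacian (convolve f u)) ∧
      4 / ((n : ℝ) + 1) ^ 2 ≤
        ⨆ f : {f : lp (fun _ : ℤ => ℂ) p // f ≠ 0}, ‖T f‖ / ‖(f : lp (fun _ : ℤ => ℂ) p)‖ ∧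
      ((⨆ f : {f : lp (fun _ : ℤ => ℂ) p // f ≠ 0}, ‖T f‖ / ‖(f : lp (fun _ : ℤ => ℂ) p)‖) =
        4 / ((n : ℝ) + 1) ^ 2 ↔ u = triangle n) := by
  have hsupp : ∀ k ∉ Icc (-n : ℤ) n, u k = 0 := fun k hk =>
    hu k (not_le.mp fun h => hk (mem_Icc.mpr (abs_le.mp h)))
  have heven (j : ℕ) (hj : Even j) : 0 ≤ fourierSeries u (j * (Real.pi / (n + 1))) := by
    obtain ⟨m, rfl⟩ := even_iff_two_dvd.mp hj
    convert hpos m using 2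
    push_cast
    ring
  set T := lpLaplacian p * lpConvolve (Icc (-n : ℤ) n) u p with hT
  have hmin (h : ‖T‖ ≤ 4 / ((n : ℝ) + 1) ^ 2) : u = triangle n :=
    eq_triangle_of_symbol_le hsupp hsum heven fun ξ =>
      (mul_norm_fourierSeries_le_norm_lpLaplacian_mul_lpConvolve p hsupp ξ).trans h
  have htri (h : u = triangle n) : ‖T‖ = 4 / ((n : ℝ) + 1) ^ 2 := by
    rw [hT, h, norm_lpLaplacian_mul_lpConvolve_triangle]
  refine ⟨T, fun f => ?_, ?_⟩
  · rw [hT, mul_apply_eq_comp, coe_lpLaplacian, coe_lpConvolve p hsupp]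
  · rw [iSup_ne_zero_norm_div_norm_eq_opNorm]
    exact ⟨le_of_not_gt fun h => h.ne (htri (hmin h.le)), fun h => hmin h.le, htri⟩

theorem theorem2 (n : ℕ) :
    (∀ u : ℤ → ℝ,
      -- `u` is a function on `{-n, …, n}`, extended by zero
      (∀ k : ℤ, (n : ℤ) < |k| → u k = 0) →
      (∀ k : ℤ, u (-k) = u k) →
      ∑ k ∈ Finset.Icc (-(n : ℤ)) n, u k = 1 →
      (∀ ξ : ℝ, 0 ≤ fourierSeries u ξ) →
      -- `T` is the (bounded) operator `f ↦ Δ(f * u)` on complex `ℓ²(ℤ)`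
      ∃ T : ℓ²(ℤ, ℂ) →L[ℂ] ℓ²(ℤ, ℂ),
        (∀ f : ℓ²(ℤ, ℂ), (T f : ℤ → ℂ) = discreteLaplacian (convolve f u)) ∧
        4 / ((n : ℝ) + 1) ^ 2 ≤ ⨆ f : {f : ℓ²(ℤ, ℂ) // f ≠ 0}, ‖T f‖ / ‖(f : ℓ²(ℤ, ℂ))‖ ∧
        ((⨆ f : {f : ℓ²(ℤ, ℂ) // f ≠ 0}, ‖T f‖ / ‖(f : ℓ²(ℤ, ℂ))‖) = 4 / ((n : ℝ) + 1) ^ 2 ↔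
          u = triangle n)) ∧
    (∀ ξ : ℝ, fourierSeries (triangle n) ξ = (normalizedFejer n ξ : ℂ)) :=
  ⟨fun _ hu _ hsum hpos => theorem2_general 2 hu hsum fun _ => hpos _, fourierSeries_triangle n⟩
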